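/- Let $a<b$ be real numbers. For an open interval $I\subseteq(a,b)$ and $f\in L^1_{\rm loc}(I)$ let $|Df|(I)=\sup\{\int_I f v'\,dx : v\in C_c^\infty(I),\ |v|\le 1\}\in[0,+\infty]$ be the total variation of $f$ on $I$, and let $BV(a,b)$ be the set of $f\in L^1(a,b)$ with $|Df|((a,b))<+\infty$. Let $J(f)=|Df|((a,b))$ for $f\in L^2(a,b)$, a functional with values in $[0,+\infty]$. The total variation flow starting from $u_0\in L^2(a,b)$ is the gradient flow of $J$ in $L^2(a,b)$, that is, the function $u:[0,\infty)\to L^2(a,b)$ that is continuous on $[0,\infty)$, absolutely continuous on every compact subinterval of $(0,\infty)$, and satisfies $u(0)=u_0$ and $u'(t)\in-\partial J(u(t))$ for almost every $t>0$, where $\partial J$ is the subdifferential. Let $u_0=\bar u_0+n$, where $\bar u_0\in BV(a,b)$ and $n$ is a stochastic process on $(a,b)$ such that, almost surely, $n\in L^2(a,b)$ and $|Dn|(I)=+\infty$ for every nonempty open interval $I\subseteq(a,b)$. Let $u(t)$ be the total variation flow starting from $u_0$. Then, almost surely, for every $t>0$ there is an open set $A(t)\subseteq(a,b)$, dense in $(a,b)$,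 such that $u(t)$ is (almost everywhere equal to a) constant on each connected component of $A(t)$. -/

import Mathlib

open MeasureTheory Set Filter Topology

noncomputable section

/-- The test functions for the total variation on the open interval `(a, b)`:
smooth functions with compact support in `(a, b)` and values in `[-1, 1]`. -/
def tvTestFunctions (a b : ℝ) : Set (ℝ → ℝ) :=
  {v | ContDiff ℝ (⊤ : ℕ∞) v ∧ HasCompactSupport v ∧ tsupport v ⊆ Ioo a b ∧ ∀ x, |v x| ≤ 1}

/-- The (distributional) total variation `|Df|((a, b))` of a locally integrable function on
`(a, b)`, i.e. the supremum of `∫_a^b f v'` over all test functions `v`; it takes values in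
`[0, +∞]`. -/
def totalVar (a b : ℝ) (f : ℝ → ℝ) : EReal :=
  ⨆ v ∈ tvTestFunctions a b, ((∫ x in Ioo a b, f x * deriv v x : ℝ) : EReal)

/-- `f ∈ BV(a, b)`: `f` is integrable on `(a, b)` with finite total variation. -/
def IsBV (a b : ℝ) (f : ℝ → ℝ) : Prop :=
  IntegrableOn f (Ioo a b) ∧ totalVar a b f < ⊤

/-- The Hilbert space `L²(a, b)`. -/
abbrev L2Ioo (a b : ℝ) : Type := Lp ℝ 2 (volume.restrict (Ioo a b))

/-- The subdifferential at `x` of a functional `J` on a real Hilbert space with values in the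
extended reals. -/
def subdiff {H : Type*} [NormedAddCommGroup H] [InnerProductSpace ℝ H]
    (J : H → EReal) (x : H) : Set H :=
  {p | J x < ⊤ ∧ ∀ z : H, J x + ((inner ℝ p (z - x) : ℝ) : EReal) ≤ J z}

/-- `u : [0, ∞) → H` is the gradient flow `u' ∈ -∂J(u)`, `u(0) = x₀`, of `J` (values of `u` at
negative times are irrelevant): `u` is continuous on `[0, ∞)`, absolutely continuous on every
compact interval in `(0, ∞)`, starts from `x₀`, and satisfies the inclusion at almost every
time. -/
structure IsGradientFlow {H : Type*} [NormedAddCommGroup H] [InnerProductSpace ℝ H]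
    (J : H → EReal) (x₀ : H) (u : ℝ → H) : Prop where
  continuousOn : ContinuousOn u (Ici 0)
  absolutelyContinuous :
    ∀ s t : ℝ, 0 < s → s ≤ t → AbsolutelyContinuousOnInterval u s t
  initial : u 0 = x₀
  inclusion : ∀ᵐ t ∂(volume.restrict (Ioi (0 : ℝ))), ∃ p ∈ subdiff J (u t), HasDerivAt u (-p) t

/-- `u` is the total variation flow on `(a, b)` starting from the function `u₀`: the gradient flow
in `L²(a, b)` of the total variation, starting from the class of `u₀`. -/
def IsTVFlow (a b : ℝ) (u₀ : ℝ → ℝ) (u : ℝ → L2Ioo a b) : Prop :=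
  ∃ h : MemLp u₀ 2 (volume.restrict (Ioo a b)),
    IsGradientFlow (fun f : L2Ioo a b => totalVar a b f) (h.toLp u₀) u

/-- `f` is (almost everywhere equal to a function which is) constant on each connected component
of `A`. -/
def ConstOnComponents (A : Set ℝ) (f : ℝ → ℝ) : Prop :=
  ∀ x ∈ A, ∃ c : ℝ, ∀ᵐ y ∂(volume.restrict (connectedComponentIn A x)), f y = c

end

/-! In dimension one the flow has an explicit form. Total variation on `L²(a, b)` is the support
function of the convex set `dualBall` of derivatives `p = P'`, where `P` vanishes at both endpoints
and `|P| ≤ 1`. The implicit Euler step of length `t` from `u₀` is `u₀ - t • p`, where `p` maximizes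
`⟪u₀ - t • p, ·⟫` on that set. For a general convex set such single steps do not compose. Here they
do, because a maximizer reached along the flow remains one later (`Supports.inner_le_of_add_smul`).
Hence `u t = u₀ - t • p` holds exactly, with `p` a maximizer for `u t`
(`IsGradientFlow.exists_supports`).

Consider the open set `{|P| < 1}`. Inside it `P` can be perturbed freely, so maximality forces `u t`
to be locally constant (`Supports.ae_const_of_Icc_subset`). If an interval missed this set, then
`|P| = 1` and `p = 0` there, so `u t = u₀` on it. The noise would then equal `u t - ubar` there, a
difference of two functions of finite variation, which is impossible. The set is therefore dense. -/

/-- `p` is a point of `C` at which the linear functional `⟪w, ·⟫` attains its maximum on `C`. -/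
def Supports {H : Type*} [NormedAddCommGroup H] [InnerProductSpace ℝ H]
    (C : Set H) (w p : H) : Prop :=
  p ∈ C ∧ ∀ k ∈ C, inner ℝ w k ≤ inner ℝ w p

/-! ### Gradient flows of support functions in a Hilbert space. -/

section Hilbert

variable {H : Type*} [NormedAddCommGroup H] [InnerProductSpace ℝ H]

/-- The point `p` is the projection of `t⁻¹ • v` onto `C`; its variational inequality, scaled by
`t`, is the claim. -/
theorem Supports.exists_sub_smul [CompleteSpace H] {C : Set H} (hne : C.Nonempty)
    (hcl : IsClosed C) (hconv : Convex ℝ C) (v : H) {t : ℝ} (ht : 0 < t) :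
    ∃ p, Supports C (v - t • p) p := by
  obtain ⟨p, hp, hmin⟩ := exists_norm_eq_iInf_of_complete_convex hne hcl.isComplete hconv (t⁻¹ • v)
  rw [norm_eq_iInf_iff_real_inner_le_zero hconv hp] at hmin
  refine ⟨p, hp, fun k hk => ?_⟩
  have h := hmin k hk
  have e : v - t • p = t • (t⁻¹ • v - p) := by
    rw [smul_sub, smul_smul, mul_inv_cancel₀ ht.ne', one_smul]
  rw [inner_sub_right] at h
  rw [e, real_inner_smul_left, real_inner_smul_left]
  exact mul_le_mul_of_nonneg_left (by linarith) ht.le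

theorem Supports.eq_of_sub_smul {C : Set H} {v p q : H} {t : ℝ} (ht : 0 < t)
    (hp : Supports C (v - t • p) p) (hq : Supports C (v - t • q) q) : p = q := by
  have h1 := hp.2 q hq.1
  have h2 := hq.2 p hp.1
  have h3 : t * inner ℝ (p - q) (p - q) ≤ 0 := by
    simp only [inner_sub_left, inner_sub_right, real_inner_smul_left] at *
    rw [real_inner_comm p q] at *
    linarith
  have h4 : inner ℝ (p - q) (p - q) ≤ 0 := by
    by_contra hc
    push Not at hc
    exact absurd h3 (not_le.2 (mul_pos ht hc))
  exact sub_eq_zero.1 (real_inner_self_nonpos.1 h4)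

/-- The minimizers `u₀ - t • p` of `J + ‖· - u₀‖² / (2t)` form a semigroup in `t`. -/
theorem Supports.semigroup [CompleteSpace H] {C : Set H} (hne : C.Nonempty)
    (hcl : IsClosed C) (hconv : Convex ℝ C)
    (hkey : ∀ (w p q : H) (h : ℝ), 0 < h → Supports C w p → Supports C (w + h • p) q →
      inner ℝ w p ≤ inner ℝ w q)
    {u₀ p q : H} {s t : ℝ} (hs : 0 < s) (hst : s < t)
    (hp : Supports C (u₀ - s • p) p) (hq : Supports C (u₀ - t • q) q) :
    ∃ r, Supports C (u₀ - t • q) r ∧ u₀ - t • q = u₀ - s • p - (t - s) • r ∧ ‖r‖ ≤ ‖p‖ := by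
  have hts : 0 < t - s := sub_pos.2 hst
  have ht : 0 < t := hs.trans hst
  obtain ⟨r, hr⟩ := Supports.exists_sub_smul hne hcl hconv (u₀ - s • p) hts
  -- `w` is a second implicit step, of length `t - s`. Since `w + (t - s) • r = u₀ - s • p` is
  -- supported by `p`, persistence makes `p` a maximizer for `w` as well as `r`.
  set w := u₀ - s • p - (t - s) • r with hw
  have hwp : inner ℝ w r ≤ inner ℝ w p := by
    refine hkey w r p (t - s) hts hr ?_
    rw [hw, sub_add_cancel]
    exact hp
  set m := (s / t) • p + ((t - s) / t) • r with hm
  have hmC : m ∈ C := hconv hp.1 hr.1 (by positivity) (by positivity) (by field_simp; ring)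
  have hwm : w = u₀ - t • m := by
    rw [hw, hm, smul_add, smul_smul, smul_smul, mul_div_cancel₀ _ ht.ne',
      mul_div_cancel₀ _ ht.ne', sub_sub]
  have hinner : inner ℝ w r ≤ inner ℝ w m := by
    rw [hm, inner_add_right, real_inner_smul_right, real_inner_smul_right]
    have : s / t * inner ℝ w r ≤ s / t * inner ℝ w p :=
      mul_le_mul_of_nonneg_left hwp (by positivity)
    have e : s / t * inner ℝ w r + (t - s) / t * inner ℝ w r = inner ℝ w r := by
      field_simp; ring
    linarith
  have hsm : Supports C (u₀ - t • m) m := by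
    rw [← hwm]
    exact ⟨hmC, fun k hk => (hr.2 k hk).trans hinner⟩
  have hmq : m = q := Supports.eq_of_sub_smul ht hsm hq
  rw [← hmq, ← hwm]
  refine ⟨r, hr, rfl, ?_⟩
  have h1 := hp.2 r hr.1
  have h5 := hr.2 p hp.1
  -- Testing the maximality of `p` with `r` and that of `r` with `p`, then adding, leaves this
  -- inequality; Cauchy-Schwarz turns it into `‖r‖ ≤ ‖p‖`.
  have h2 : (t - s) * inner ℝ r (r - p) ≤ 0 := by
    have : u₀ - s • p = w + (t - s) • r := by rw [hw, sub_add_cancel]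
    rw [this, inner_add_left, inner_add_left, real_inner_smul_left, real_inner_smul_left] at h1
    rw [inner_sub_right]
    linarith
  have h3 : inner ℝ r (r - p) ≤ 0 := by
    by_contra hc
    push Not at hc
    exact absurd h2 (not_le.2 (mul_pos hts hc))
  rw [inner_sub_right, real_inner_self_eq_norm_sq] at h3
  have h4 := real_inner_le_norm r p
  by_contra hc
  push Not at hc
  nlinarith [norm_nonneg p, norm_nonneg r]

/-- This is monotonicity of the subdifferential. `J` is bounded above by the support function only
at points having a maximizer, which is all the comparison needs. -/
theorem inner_sub_sub_nonpos_of_mem_subdiff {J : H → EReal} {C : Set H}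
    (hle : ∀ p ∈ C, ∀ z, ((inner ℝ p z : ℝ) : EReal) ≤ J z)
    (hge : ∀ w p, Supports C w p → J w ≤ ((inner ℝ w p : ℝ) : EReal))
    {x y p q : H} (hp : p ∈ subdiff J x) (hq : Supports C y q) :
    inner ℝ (x - y) (q - p) ≤ 0 := by
  have h1 := (hp.2 y).trans (hge y q hq)
  have h2 := hle q hq.1 x
  have h3 : ((inner ℝ q x : ℝ) : EReal) + ((inner ℝ p (y - x) : ℝ) : EReal)
      ≤ ((inner ℝ y q : ℝ) : EReal) := (add_le_add_left h2 _).trans h1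
  have h4 : inner ℝ q x + inner ℝ p (y - x) ≤ inner ℝ y q := by exact_mod_cast h3
  simp only [inner_sub_left, inner_sub_right] at *
  rw [real_inner_comm x q, real_inner_comm y p, real_inner_comm x p] at *
  linarith

theorem norm_sq_sub_norm_sq_le (x y : H) : ‖x‖ ^ 2 - ‖y‖ ^ 2 ≤ 2 * inner ℝ x (x - y) := by
  have h := norm_sub_sq_real x y
  have h' := sq_nonneg ‖x - y‖
  rw [inner_sub_right, real_inner_self_eq_norm_sq]
  linarith

theorem AbsolutelyContinuousOnInterval.norm_sq {F : Type*} [NormedAddCommGroup F]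
    {x : ℝ → F} {s t : ℝ}
    (h : AbsolutelyContinuousOnInterval x s t) :
    AbsolutelyContinuousOnInterval (fun τ => ‖x τ‖ ^ 2) s t := by
  have h1 : AbsolutelyContinuousOnInterval (fun τ => ‖x τ‖) s t := by
    refine squeeze_zero (fun E => Finset.sum_nonneg fun i _ => dist_nonneg) (fun E => ?_) h
    exact Finset.sum_le_sum fun i _ =>
      (dist_norm_norm_le _ _).trans_eq (dist_eq_norm _ _).symm
  simpa only [sq] using h1.fun_mul h1

theorem AbsolutelyContinuousOnInterval.le_of_ae_deriv_nonpos {g : ℝ → ℝ} {s t : ℝ} (hst : s ≤ t)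
    (h : AbsolutelyContinuousOnInterval g s t)
    (hd : ∀ᵐ τ, τ ∈ Ioc s t → DifferentiableAt ℝ g τ → deriv g τ ≤ 0) : g t ≤ g s := by
  have h1 := h.integral_deriv_eq_sub
  have h2 : ∫ τ in s..t, deriv g τ ≤ 0 := by
    rw [intervalIntegral.integral_of_le hst]
    refine integral_nonpos_of_ae ?_
    rw [EventuallyLE, ae_restrict_iff' measurableSet_Ioc]
    filter_upwards [hd, h.ae_differentiableAt] with τ h1 h2 h3
    exact h1 h3 (h2 (by rw [uIcc_of_le hst]; exact Ioc_subset_Icc_self h3))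
  linarith

/-- Meant for `g = ‖u - v‖²` with `x = u`: only `u` and the scalar `g` need derivatives, so no
differentiability of the Lipschitz curve `v` is required. -/
theorem deriv_nonpos_of_left_slope_le {g : ℝ → ℝ} {τ : ℝ} {x : ℝ → H} {x' z : H}
    (hg : DifferentiableAt ℝ g τ) (hx : HasDerivAt x x' τ)
    (h : ∀ᶠ σ in 𝓝[<] τ, slope g τ σ ≤ 2 * inner ℝ z (slope x τ σ - x')) : deriv g τ ≤ 0 := by
  have hsub : 𝓝[<] τ ≤ 𝓝[≠] τ := nhdsWithin_mono _ fun y hy => ne_of_lt hy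
  have h1 := (hasDerivAt_iff_tendsto_slope.1 hg.hasDerivAt).mono_left hsub
  have h2 := (hasDerivAt_iff_tendsto_slope.1 hx).mono_left hsub
  have h3 : Tendsto (fun σ => 2 * inner ℝ z (slope x τ σ - x')) (𝓝[<] τ) (𝓝 0) := by
    have := ((tendsto_const_nhds (x := z)).inner (𝕜 := ℝ) (h2.sub_const x')).const_mul 2
    simpa using this
  exact le_of_tendsto_of_tendsto h1 h3 h

theorem Supports.norm_smul_sq_le {C : Set H} (h0 : (0 : H) ∈ C) {u₀ p g : H} {s M : ℝ} (hs : 0 < s)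
    (hp : Supports C (u₀ - s • p) p) (hM : inner ℝ g p ≤ M) :
    ‖s • p‖ ^ 2 ≤ s * M + ‖u₀ - g‖ * ‖u₀‖ := by
  have h1 : ‖s • p‖ ^ 2 ≤ inner ℝ u₀ (s • p) := by
    have := hp.2 0 h0
    rw [inner_zero_right, inner_sub_left, real_inner_smul_left, real_inner_self_eq_norm_sq] at this
    rw [norm_smul, real_inner_smul_right, Real.norm_of_nonneg hs.le]
    nlinarith
  have h2 : ‖s • p‖ ≤ ‖u₀‖ := by
    have := real_inner_le_norm u₀ (s • p)
    by_contra hc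
    push Not at hc
    nlinarith [norm_nonneg u₀]
  have h3 : inner ℝ u₀ (s • p) = s * inner ℝ g p + inner ℝ (u₀ - g) (s • p) := by
    rw [inner_sub_left, real_inner_smul_right g]
    ring
  have h4 := real_inner_le_norm (u₀ - g) (s • p)
  have h5 := mul_le_mul_of_nonneg_left h2 (norm_nonneg (u₀ - g))
  have h6 := mul_le_mul_of_nonneg_left hM hs.le
  linarith

/-- The vectors `g` on which the support function is finite are dense. For `g` close to `u₀`, the
bound `s * M + ‖u₀ - g‖ * ‖u₀‖` is small once `s` is small. -/
theorem Supports.tendsto_smul_zero {C : Set H} (h0 : (0 : H) ∈ C)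
    (hdense : ∀ (z : H) (ε : ℝ), 0 < ε → ∃ g M, ‖z - g‖ < ε ∧ ∀ p ∈ C, inner ℝ g p ≤ M)
    {u₀ : H} {π : ℝ → H} (hπ : ∀ s, 0 < s → Supports C (u₀ - s • π s) (π s)) :
    Tendsto (fun s => s • π s) (𝓝[>] 0) (𝓝 0) := by
  have hsq : Tendsto (fun s => ‖s • π s‖ ^ 2) (𝓝[>] 0) (𝓝 0) := by
    rw [Metric.tendsto_nhdsWithin_nhds]
    intro ε hε
    obtain ⟨g, M, hg, hM⟩ := hdense u₀ (ε / (2 * (‖u₀‖ + 1))) (by positivity)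
    refine ⟨ε / (2 * (|M| + 1)), by positivity, fun {s} hs hd => ?_⟩
    have hs' : 0 < s := hs
    have h1 := Supports.norm_smul_sq_le h0 hs' (hπ s hs') (hM _ (hπ s hs').1)
    rw [Real.dist_eq, sub_zero, abs_of_pos hs'] at hd
    rw [Real.dist_eq, sub_zero, abs_of_nonneg (sq_nonneg _)]
    rw [lt_div_iff₀ (by positivity)] at hd hg
    have h2 : s * M ≤ s * |M| := mul_le_mul_of_nonneg_left (le_abs_self M) hs'.le
    nlinarith [norm_nonneg (u₀ - g)]
  rw [tendsto_zero_iff_norm_tendsto_zero]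
  have := hsq.sqrt
  simpa using this

/-- The gradient flow of a positively one-homogeneous functional `J`, the support function of `C`,
is given by `u t = u₀ - t • p` with `p` a maximizer of `⟪u t, ·⟫` on `C`, provided that the
maximizers persist along the flow. -/
theorem IsGradientFlow.exists_supports [CompleteSpace H] {J : H → EReal} {C : Set H}
    (h0 : (0 : H) ∈ C) (hcl : IsClosed C) (hconv : Convex ℝ C)
    (hle : ∀ p ∈ C, ∀ z, ((inner ℝ p z : ℝ) : EReal) ≤ J z)
    (hge : ∀ w p, Supports C w p → J w ≤ ((inner ℝ w p : ℝ) : EReal))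
    (hkey : ∀ (w p q : H) (h : ℝ), 0 < h → Supports C w p → Supports C (w + h • p) q →
      inner ℝ w p ≤ inner ℝ w q)
    (hdense : ∀ (z : H) (ε : ℝ), 0 < ε → ∃ g M, ‖z - g‖ < ε ∧ ∀ p ∈ C, inner ℝ g p ≤ M)
    {u₀ : H} {u : ℝ → H} (hu : IsGradientFlow J u₀ u) {t : ℝ} (ht : 0 < t) :
    ∃ p, Supports C (u t) p ∧ u t = u₀ - t • p := by
  have hex : ∀ s : ℝ, ∃ p, 0 < s → Supports C (u₀ - s • p) p := fun s => by
    by_cases hs : 0 < s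
    · obtain ⟨p, hp⟩ := Supports.exists_sub_smul ⟨0, h0⟩ hcl hconv u₀ hs
      exact ⟨p, fun _ => hp⟩
    · exact ⟨0, fun h => absurd h hs⟩
  choose π hπ using hex
  -- The explicit candidate. It is Lipschitz away from time `0`, the distance from `u` to it is
  -- nonincreasing, and both curves tend to `u₀` at time `0`; hence they coincide.
  set v : ℝ → H := fun s => u₀ - s • π s with hv
  have hstep : ∀ s τ, 0 < s → s < τ →
      ∃ r, Supports C (v τ) r ∧ v τ = v s - (τ - s) • r ∧ ‖r‖ ≤ ‖π s‖ := fun s τ hs hsτ =>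
    Supports.semigroup ⟨0, h0⟩ hcl hconv hkey hs hsτ (hπ s hs) (hπ τ (hs.trans hsτ))
  have hnorm : ∀ s τ, 0 < s → s ≤ τ → ‖π τ‖ ≤ ‖π s‖ := by
    intro s τ hs hsτ
    rcases hsτ.eq_or_lt with rfl | hlt
    · rfl
    obtain ⟨r, hr, hvr, hle⟩ := hstep s τ hs hlt
    have hτ := hs.trans hlt
    have e : τ • π τ = s • π s + (τ - s) • r := by
      have h1 : u₀ - τ • π τ = u₀ - s • π s - (τ - s) • r := hvr
      rw [sub_sub] at h1
      exact sub_right_injective h1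
    have h2 : τ * ‖π τ‖ ≤ s * ‖π s‖ + (τ - s) * ‖r‖ := by
      have := norm_add_le (s • π s) ((τ - s) • r)
      rwa [← e, norm_smul, norm_smul, norm_smul, Real.norm_of_nonneg hτ.le,
        Real.norm_of_nonneg hs.le, Real.norm_of_nonneg (sub_pos.2 hlt).le] at this
    have h3 := mul_le_mul_of_nonneg_left hle (sub_pos.2 hlt).le
    refine le_of_mul_le_mul_left ?_ hτ
    linarith
  have hdist : ∀ s σ τ, 0 < s → s ≤ σ → σ ≤ τ → dist (v σ) (v τ) ≤ ‖π s‖ * dist σ τ := by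
    intro s σ τ hs hsσ hστ
    rcases hστ.eq_or_lt with rfl | hlt
    · simp
    obtain ⟨r, hr, hvr, hle⟩ := hstep σ τ (hs.trans_le hsσ) hlt
    rw [hvr, dist_eq_norm, sub_sub_cancel, norm_smul, Real.dist_eq, abs_sub_comm,
      Real.norm_eq_abs, mul_comm]
    exact mul_le_mul_of_nonneg_right (hle.trans (hnorm s σ hs hsσ)) (abs_nonneg _)
  have hmono : ∀ s τ, 0 < s → s ≤ τ → ‖u τ - v τ‖ ^ 2 ≤ ‖u s - v s‖ ^ 2 := by
    intro s τ hs hsτ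
    have hvac : AbsolutelyContinuousOnInterval v s τ := by
      refine LipschitzOnWith.absolutelyContinuousOnInterval (K := ‖π s‖₊) ?_
      refine LipschitzOnWith.of_dist_le_mul fun x hx y hy => ?_
      rw [uIcc_of_le hsτ] at hx hy
      rcases le_total x y with hxy | hxy
      · exact hdist s x y hs hx.1 hxy
      · rw [dist_comm, dist_comm x]
        exact hdist s y x hs hy.1 hxy
    refine AbsolutelyContinuousOnInterval.le_of_ae_deriv_nonpos
      (g := fun τ => ‖u τ - v τ‖ ^ 2) hsτ
      ((hu.absolutelyContinuous s τ hs hsτ).fun_sub hvac).norm_sq ?_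
    have hinc := hu.inclusion
    rw [ae_restrict_iff' measurableSet_Ioi] at hinc
    filter_upwards [hinc] with r hr hrs hdiff
    have hr0 : 0 < r := hs.trans hrs.1
    obtain ⟨p, hp, hder⟩ := hr hr0
    refine deriv_nonpos_of_left_slope_le (z := u r - v r) hdiff hder ?_
    -- Backward differences are used because the step from `σ` to `r` produces a maximizer at its
    -- endpoint `v r`, where it can be compared with the subgradient at `u r`.
    filter_upwards [Ioo_mem_nhdsLT hr0] with σ hσ
    obtain ⟨q, hq, hvq, -⟩ := hstep σ r hσ.1 hσ.2
    have h1 := norm_sq_sub_norm_sq_le (u r - v r) (u σ - v σ)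
    have h2 := inner_sub_sub_nonpos_of_mem_subdiff hle hge hp hq
    have hpos : 0 < r - σ := sub_pos.2 hσ.2
    have e1 : u r - v r - (u σ - v σ) = (u r - u σ) + (r - σ) • q := by
      have : v σ = v r + (r - σ) • q := by rw [hvq, sub_add_cancel]
      rw [this]; abel
    have e2 : slope u r σ = (r - σ)⁻¹ • (u r - u σ) := by
      rw [slope_comm, slope_def_module]
    have e3 : slope (fun τ => ‖u τ - v τ‖ ^ 2) r σ
        = (r - σ)⁻¹ * (‖u r - v r‖ ^ 2 - ‖u σ - v σ‖ ^ 2) := by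
      rw [slope_comm, slope_def_module, smul_eq_mul]
    rw [e3, e2, inv_mul_le_iff₀ hpos]
    rw [e1] at h1
    refine h1.trans ?_
    simp only [inner_add_right, inner_sub_right (𝕜 := ℝ) (u r - v r), real_inner_smul_right,
      inner_neg_right] at h2 ⊢
    have e4 : ∀ c : ℝ, (r - σ) * (2 * ((r - σ)⁻¹ * c - -inner ℝ (u r - v r) p))
        = 2 * (c + (r - σ) * inner ℝ (u r - v r) p) := fun c => by field_simp; ring
    rw [e4]
    nlinarith
  have hlim : Tendsto (fun s => ‖u s - v s‖ ^ 2) (𝓝[>] 0) (𝓝 0) := by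
    have h1 : Tendsto u (𝓝[>] 0) (𝓝 u₀) := by
      have := (hu.continuousOn 0 self_mem_Ici).tendsto
      rw [hu.initial] at this
      exact this.mono_left (nhdsWithin_mono _ Ioi_subset_Ici_self)
    have h2 := Supports.tendsto_smul_zero h0 hdense (u₀ := u₀) (π := π) fun s hs => hπ s hs
    have h3 : Tendsto v (𝓝[>] 0) (𝓝 (u₀ - 0)) := tendsto_const_nhds.sub h2
    have := ((h1.sub h3).norm.pow 2)
    simpa using this
  have hzero : ‖u t - v t‖ ^ 2 ≤ 0 := by
    refine ge_of_tendsto hlim ?_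
    filter_upwards [Ioo_mem_nhdsGT ht] with s hs
    exact hmono s t hs.1 hs.2.le
  have huv : u t = v t := by
    have : ‖u t - v t‖ = 0 := by nlinarith [norm_nonneg (u t - v t)]
    exact sub_eq_zero.1 (norm_eq_zero.1 this)
  exact ⟨π t, huv ▸ hπ t ht, huv⟩

end Hilbert

/-! ### Primitives, their positive parts, and the dual ball. -/

theorem max_zero_add_integral_eq {f : ℝ → ℝ} {a b c x : ℝ}
    (hf : IntervalIntegrable f volume a b) (hc : c ≤ 0) (hx : x ∈ Icc a b) :
    max (c + ∫ y in a..x, f y) 0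
      = ∫ y in a..x, {y ∈ Ioo a b | 0 < c + ∫ z in a..y, f z}.indicator f y := by
  have hab : a ≤ b := hx.1.trans hx.2
  set F : ℝ → ℝ := fun x => c + ∫ y in a..x, f y with hF
  set G : ℝ → ℝ := fun x => max (F x) 0 with hG
  have hI : AbsolutelyContinuousOnInterval (fun x => ∫ y in a..x, f y) a x :=
    (hf.absolutelyContinuousOnInterval_intervalIntegral left_mem_uIcc).mono
      (by rw [uIcc_of_le hx.1, uIcc_of_le hab]; exact Icc_subset_Icc_right hx.2)
  have hGac : AbsolutelyContinuousOnInterval G a x := by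
    refine squeeze_zero (fun E => Finset.sum_nonneg fun i _ => dist_nonneg)
      (fun E => Finset.sum_le_sum fun i _ => ?_) hI
    rw [Real.dist_eq, Real.dist_eq]
    refine (abs_max_sub_max_le_abs _ _ _).trans_eq ?_
    rw [hF, add_sub_add_left_eq_sub]
  have hGa : G a = 0 := by simp [hG, hF, hc]
  have h1 := hGac.integral_deriv_eq_sub
  rw [hGa, sub_zero] at h1
  change G x = _
  rw [← h1]
  refine intervalIntegral.integral_congr_ae ?_
  have hb : ∀ᵐ y : ℝ, y ≠ b := by simp [ae_iff, measure_singleton]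
  filter_upwards [hGac.ae_differentiableAt, hf.ae_hasDerivAt_integral, hb] with y hdG hdF hyb hy
  rw [uIoc_of_le hx.1] at hy
  have hy' : y ∈ Ioo a b := ⟨hy.1, lt_of_le_of_ne (hy.2.trans hx.2) hyb⟩
  have hdF' : HasDerivAt F (f y) y :=
    (hdF (by rw [uIcc_of_le hab]; exact Ioo_subset_Icc_self hy') a left_mem_uIcc).const_add c
  by_cases hpos : 0 < F y
  · rw [indicator_of_mem (show y ∈ {y ∈ Ioo a b | 0 < F y} from ⟨hy', hpos⟩)]
    refine (hdF'.congr_of_eventuallyEq ?_).deriv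
    filter_upwards [hdF'.continuousAt.eventually (lt_mem_nhds hpos)] with z hz
    exact max_eq_left hz.le
  · rw [indicator_of_notMem fun h : y ∈ {y ∈ Ioo a b | 0 < F y} => hpos h.2]
    -- Where `F ≤ 0` the positive part attains its minimum value `0`, so its derivative vanishes
    -- there.
    refine IsLocalMin.deriv_eq_zero (Eventually.of_forall fun z => ?_)
    have : G y = 0 := max_eq_right (not_lt.1 hpos)
    rw [this]
    exact le_max_right _ _

section Primitive

variable {a b : ℝ}

theorem L2Ioo.intervalIntegrable (p : L2Ioo a b) {c d : ℝ} (hc : c ∈ Icc a b) (hd : d ∈ Icc a b) :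
    IntervalIntegrable p volume c d := by
  have h1 : IntegrableOn p (Ioo a b) := (Lp.memLp p).integrable one_le_two
  rw [← integrableOn_Ioc_iff_integrableOn_Ioo] at h1
  have h2 : IntervalIntegrable p volume a b :=
    (intervalIntegrable_iff_integrableOn_Ioc_of_le (hc.1.trans hc.2)).2 h1
  refine h2.mono_set ?_
  rw [uIcc_of_le (hc.1.trans hc.2)]
  exact uIcc_subset_Icc hc hd

/-- The class in `L²(a, b)` of the indicator function of `(-∞, x)`. -/
noncomputable def cutoff (a b x : ℝ) : L2Ioo a b :=
  indicatorConstLp 2 (measurableSet_Iio (a := x)) (measure_ne_top _ _) (1 : ℝ)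

/-- The primitive of an element of `L²(a, b)` vanishing at `a`. -/
noncomputable def primitive (p : L2Ioo a b) (x : ℝ) : ℝ := inner ℝ (cutoff a b x) p

theorem primitive_add (p q : L2Ioo a b) (x : ℝ) :
    primitive (p + q) x = primitive p x + primitive q x := inner_add_right _ _ _

theorem primitive_sub (p q : L2Ioo a b) (x : ℝ) :
    primitive (p - q) x = primitive p x - primitive q x := inner_sub_right _ _ _

theorem primitive_neg (p : L2Ioo a b) (x : ℝ) : primitive (-p) x = -primitive p x :=
  inner_neg_right _ _

theorem primitive_smul (c : ℝ) (p : L2Ioo a b) (x : ℝ) :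
    primitive (c • p) x = c * primitive p x := real_inner_smul_right _ _ _

theorem primitive_eq_integral (p : L2Ioo a b) {x : ℝ} (hx : x ∈ Icc a b) :
    primitive p x = ∫ y in a..x, p y := by
  rw [primitive, cutoff, L2.inner_indicatorConstLp_one, Measure.restrict_restrict measurableSet_Iio,
    intervalIntegral.integral_of_le hx.1, integral_Ioc_eq_integral_Ioo, Iio_inter_Ioo,
    min_eq_left hx.2]

theorem primitive_left (hab : a ≤ b) (p : L2Ioo a b) : primitive p a = 0 := by
  rw [primitive_eq_integral p (left_mem_Icc.2 hab), intervalIntegral.integral_same]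

theorem abs_primitive_le (p : L2Ioo a b) (x : ℝ) :
    |primitive p x| ≤ √(volume.real (Ioo a b)) * ‖p‖ := by
  refine (abs_real_inner_le_norm _ _).trans (mul_le_mul_of_nonneg_right ?_ (norm_nonneg _))
  refine norm_indicatorConstLp_le.trans ?_
  rw [norm_one, one_mul, ENNReal.toReal_ofNat, ← Real.sqrt_eq_rpow]
  refine Real.sqrt_le_sqrt ?_
  rw [measureReal_restrict_apply measurableSet_Iio]
  exact measureReal_mono inter_subset_right measure_Ioo_lt_top.ne

theorem primitive_toLp {f : ℝ → ℝ} (hf : MemLp f 2 (volume.restrict (Ioo a b))) {x : ℝ}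
    (hx : x ∈ Icc a b) : primitive (hf.toLp f) x = ∫ y in a..x, f y := by
  rw [primitive_eq_integral _ hx, intervalIntegral.integral_of_le hx.1,
    intervalIntegral.integral_of_le hx.1, integral_Ioc_eq_integral_Ioo,
    integral_Ioc_eq_integral_Ioo]
  exact integral_congr_ae (ae_restrict_of_ae_restrict_of_subset (Ioo_subset_Ioo_right hx.2)
    hf.coeFn_toLp)

theorem continuousOn_primitive (p : L2Ioo a b) (hab : a ≤ b) :
    ContinuousOn (primitive p) (Icc a b) := by
  have h := ((p.intervalIntegrable (left_mem_Icc.2 hab)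
    (right_mem_Icc.2 hab)).absolutelyContinuousOnInterval_intervalIntegral left_mem_uIcc).continuousOn
  rw [uIcc_of_le hab] at h
  exact h.congr fun x hx => primitive_eq_integral p hx

theorem ae_hasDerivAt_primitive (p : L2Ioo a b) :
    ∀ᵐ x, x ∈ Ioo a b → HasDerivAt (primitive p) (p x) x := by
  rcases le_or_gt b a with hab | hab
  · simp [Ioo_eq_empty (not_lt.2 hab)]
  filter_upwards [(p.intervalIntegrable (left_mem_Icc.2 hab.le)
    (right_mem_Icc.2 hab.le)).ae_hasDerivAt_integral] with x hx hxI
  refine (hx (by rw [uIcc_of_le hab.le]; exact Ioo_subset_Icc_self hxI) a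
    left_mem_uIcc).congr_of_eventuallyEq ?_
  filter_upwards [Icc_mem_nhds hxI.1 hxI.2] with y hy
  exact primitive_eq_integral p hy

theorem eq_zero_of_primitive_eq_zero {p : L2Ioo a b} (h : ∀ x ∈ Icc a b, primitive p x = 0) :
    p = 0 := by
  refine (Lp.eq_zero_iff_ae_eq_zero).2 ?_
  rw [EventuallyEq, ae_restrict_iff' measurableSet_Ioo]
  filter_upwards [ae_hasDerivAt_primitive p] with x hx hxI
  refine (hx hxI).unique ((hasDerivAt_const x (0 : ℝ)).congr_of_eventuallyEq ?_)
  filter_upwards [Icc_mem_nhds hxI.1 hxI.2] with y hy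
  exact h y hy

theorem eq_of_primitive_eq {p q : L2Ioo a b} (h : ∀ x ∈ Icc a b, primitive p x = primitive q x) :
    p = q :=
  sub_eq_zero.1 <| eq_zero_of_primitive_eq_zero fun x hx => by
    rw [primitive_sub, h x hx, sub_self]

/-- The truncation of `p` to the set on which `c + primitive p` is positive. -/
theorem exists_indicator_primitive_eq_max (p : L2Ioo a b) {c : ℝ} (hc : c ≤ 0) :
    ∃ (S : Set ℝ) (k : L2Ioo a b), k =ᵐ[volume.restrict (Ioo a b)] S.indicator p ∧
      ∀ x ∈ Icc a b, primitive k x = max (c + primitive p x) 0 := by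
  rcases le_or_gt a b with hab | hab
  · set S := {y ∈ Ioo a b | 0 < c + ∫ z in a..y, p z} with hS
    have hSm : MeasurableSet S := by
      have hcont : ContinuousOn (fun y => c + ∫ z in a..y, p z) (Ioo a b) :=
        continuousOn_const.add (((continuousOn_primitive p hab).mono Ioo_subset_Icc_self).congr
          fun x hx => (primitive_eq_integral p (Ioo_subset_Icc_self hx)).symm)
      exact (hcont.isOpen_inter_preimage isOpen_Ioo isOpen_Ioi).measurableSet
    have hmem := (Lp.memLp p).indicator hSm
    refine ⟨S, hmem.toLp _, hmem.coeFn_toLp, fun x hx => ?_⟩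
    rw [primitive_toLp hmem hx, primitive_eq_integral p hx, max_zero_add_integral_eq
      (p.intervalIntegrable (left_mem_Icc.2 hab) (right_mem_Icc.2 hab)) hc hx]
  · refine ⟨∅, 0, ?_, fun x hx => absurd (hx.1.trans hx.2) (not_le.2 hab)⟩
    rw [indicator_empty]
    exact Lp.coeFn_zero _ _ _

/-- The derivatives of the functions in `H¹₀(a, b)` with values in `[-1, 1]`. -/
def dualBall (a b : ℝ) : Set (L2Ioo a b) :=
  {p | (∀ x ∈ Icc a b, |primitive p x| ≤ 1) ∧ primitive p b = 0}

theorem zero_mem_dualBall : (0 : L2Ioo a b) ∈ dualBall a b := by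
  simp [dualBall, primitive]

theorem neg_mem_dualBall {p : L2Ioo a b} (hp : p ∈ dualBall a b) : -p ∈ dualBall a b := by
  refine ⟨fun x hx => ?_, ?_⟩
  · rw [primitive_neg, abs_neg]
    exact hp.1 x hx
  · rw [primitive_neg, hp.2, neg_zero]

theorem continuous_primitive_left (x : ℝ) : Continuous fun p : L2Ioo a b => primitive p x :=
  continuous_const.inner continuous_id

theorem isClosed_dualBall : IsClosed (dualBall a b) := by
  have : dualBall a b = (⋂ x ∈ Icc a b, {p | |primitive p x| ≤ 1}) ∩ {p | primitive p b = 0} := by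
    ext p
    simp [dualBall]
  rw [this]
  refine IsClosed.inter (isClosed_biInter fun x _ => ?_) ?_
  · exact isClosed_le (continuous_primitive_left x).abs continuous_const
  · exact isClosed_eq (continuous_primitive_left b) continuous_const

theorem convex_dualBall : Convex ℝ (dualBall a b) := by
  intro p hp q hq s t hs ht hst
  refine ⟨fun x hx => ?_, ?_⟩
  · have h1 := abs_le.1 (hp.1 x hx)
    have h2 := abs_le.1 (hq.1 x hx)
    rw [primitive_add, primitive_smul, primitive_smul, abs_le]
    constructor <;> nlinarith
  · rw [primitive_add, primitive_smul, primitive_smul, hp.2, hq.2]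
    ring

theorem Supports.neg_dualBall {w p : L2Ioo a b} (h : Supports (dualBall a b) w p) :
    Supports (dualBall a b) (-w) (-p) := by
  refine ⟨neg_mem_dualBall h.1, fun k hk => ?_⟩
  have := h.2 (-k) (neg_mem_dualBall hk)
  rwa [inner_neg_right, ← inner_neg_left, ← neg_neg (inner ℝ w p), ← inner_neg_left,
    ← inner_neg_right] at this

/-! ### Persistence of maximizers in dimension one. -/

/-- On `S` the integrand is a completed square: `p (r + p/ε) = ε (p/ε + r/2)² - ε r²/4`. -/
theorem neg_mul_norm_sq_le_inner_indicator {p r k : L2Ioo a b} {S : Set ℝ} {ε : ℝ} (hε : 0 < ε)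
    (hk : k =ᵐ[volume.restrict (Ioo a b)] S.indicator (r + ε⁻¹ • p : L2Ioo a b)) :
    -(ε / 4 * ‖r‖ ^ 2) ≤ inner ℝ p k := by
  have e : -(ε / 4 * ‖r‖ ^ 2) = inner ℝ ((-(ε / 4)) • r) r := by
    rw [real_inner_smul_left, real_inner_self_eq_norm_sq]; ring
  rw [e, L2.inner_def, L2.inner_def]
  refine integral_mono_ae (L2.integrable_inner _ _) (L2.integrable_inner _ _) ?_
  filter_upwards [hk, Lp.coeFn_add r (ε⁻¹ • p), Lp.coeFn_smul ε⁻¹ p,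
    Lp.coeFn_smul (-(ε / 4)) r] with x h1 h2 h3 h4
  simp only [RCLike.inner_apply, conj_trivial]
  rw [h1, h4]
  by_cases hx : x ∈ S
  · rw [indicator_of_mem hx, h2, Pi.add_apply, h3, Pi.smul_apply, Pi.smul_apply, smul_eq_mul,
      smul_eq_mul]
    have : (r x + ε⁻¹ * p x) * p x - r x * (-(ε / 4) * r x)
        = ε * (ε⁻¹ * p x + r x / 2) ^ 2 := by
      field_simp; ring
    have h0 : 0 ≤ ε * (ε⁻¹ * p x + r x / 2) ^ 2 := by positivity
    linarith
  · rw [indicator_of_notMem hx, Pi.smul_apply, smul_eq_mul, zero_mul]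
    nlinarith [mul_self_nonneg (r x)]

/-- Write `P`, `Q` for the primitives. Testing `q` with `q + k` alone would leave the term `h * ⟪p,
k⟫`, which has no evident sign. The positive part of `P - Q` is therefore replaced by that of `P - Q
- (1 - P)/ε`, with derivative `l`. The penalty makes `⟪p, l⟫` nonnegative up to `O(ε)`, and
maximality of `p` controls the replacement. -/
theorem Supports.inner_posPart_nonpos {w p q : L2Ioo a b} {h : ℝ} (hab : a ≤ b) (hh : 0 < h)
    (hp : Supports (dualBall a b) w p) (hq : Supports (dualBall a b) (w + h • p) q)
    {k : L2Ioo a b} (hk : ∀ x ∈ Icc a b, primitive k x = max (primitive (p - q) x) 0) :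
    inner ℝ w k ≤ 0 := by
  have hb : b ∈ Icc a b := right_mem_Icc.2 hab
  have main : ∀ ε : ℝ, 0 < ε → inner ℝ w k ≤ h * (ε / 4 * ‖p - q‖ ^ 2) := by
    intro ε hε
    obtain ⟨S, l, hl, hlF⟩ := exists_indicator_primitive_eq_max (p - q + ε⁻¹ • p)
      (c := -ε⁻¹) (by simp [hε.le])
    have hF : ∀ x, -ε⁻¹ + primitive (p - q + ε⁻¹ • p) x
        = primitive p x - primitive q x - ε⁻¹ * (1 - primitive p x) := fun x => by
      rw [primitive_add, primitive_sub, primitive_smul]; ring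
    simp only [hF] at hlF
    simp only [primitive_sub] at hk
    -- The primitive of `q + l` is `max Q (P - (1 - P)/ε)`, which stays below `1` because `P ≤ 1`.
    have hq1 : q + l ∈ dualBall a b := by
      refine ⟨fun x hx => ?_, ?_⟩
      · have h1 := abs_le.1 (hp.1.1 x hx)
        have h2 := abs_le.1 (hq.1.1 x hx)
        have h3 : 0 ≤ ε⁻¹ * (1 - primitive p x) := mul_nonneg (by positivity) (by linarith)
        rw [primitive_add, hlF x hx, abs_le]
        rcases max_cases (primitive p x - primitive q x - ε⁻¹ * (1 - primitive p x)) 0 with h | h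
          <;> constructor <;> linarith
      · rw [primitive_add, hlF b hb, hp.1.2, hq.1.2, max_eq_right] <;> simp [hε.le]
    -- The primitive of `k - l` lies between `0` and `(1 - P)/ε`, so multiplied by `ε` it fits in
    -- the gap between `P` and `1`.
    have hp1 : p + ε • (k - l) ∈ dualBall a b := by
      refine ⟨fun x hx => ?_, ?_⟩
      · have h1 := abs_le.1 (hp.1.1 x hx)
        have h3 : 0 ≤ ε⁻¹ * (1 - primitive p x) := mul_nonneg (by positivity) (by linarith)
        have h4 : 0 ≤ primitive (k - l) x ∧ primitive (k - l) x ≤ ε⁻¹ * (1 - primitive p x) := by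
          rw [primitive_sub, hk x hx, hlF x hx]
          rcases max_cases (primitive p x - primitive q x) 0 with h | h <;>
          rcases max_cases (primitive p x - primitive q x - ε⁻¹ * (1 - primitive p x)) 0
            with h' | h' <;> constructor <;> linarith
        have h5 := mul_le_mul_of_nonneg_left h4.2 hε.le
        rw [mul_inv_cancel_left₀ hε.ne'] at h5
        have h6 := mul_nonneg hε.le h4.1
        rw [primitive_add, primitive_smul, abs_le]
        constructor <;> linarith
      · rw [primitive_add, primitive_smul, primitive_sub, hk b hb, hlF b hb, hp.1.2, hq.1.2,
          max_eq_right (by simp), max_eq_right] <;> simp [hε.le]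
    have i1 := hq.2 _ hq1
    have i2 := hp.2 _ hp1
    have i3 := neg_mul_norm_sq_le_inner_indicator hε hl
    rw [inner_add_right, inner_add_left _ _ l, real_inner_smul_left _ l] at i1
    rw [inner_add_right, real_inner_smul_right, inner_sub_right] at i2
    have i4 : inner ℝ w k - inner ℝ w l ≤ 0 := by
      by_contra hc
      push Not at hc
      have := mul_pos hε hc
      linarith
    have i5 := mul_le_mul_of_nonneg_left i3 hh.le
    linarith
  have hlim : Tendsto (fun ε : ℝ => h * (ε / 4 * ‖p - q‖ ^ 2)) (𝓝[>] 0) (𝓝 0) := by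
    have hc : Continuous fun ε : ℝ => h * (ε / 4 * ‖p - q‖ ^ 2) := by fun_prop
    have := (hc.tendsto 0).mono_left (nhdsWithin_le_nhds (s := Ioi 0))
    simpa using this
  exact ge_of_tendsto hlim (eventually_nhdsWithin_of_forall fun ε hε => main ε hε)

/-- Maximizers of `⟪w + h • p, ·⟫` remain maximizers of `⟪w, ·⟫`. -/
theorem Supports.inner_le_of_add_smul {w p q : L2Ioo a b} {h : ℝ} (hab : a ≤ b) (hh : 0 < h)
    (hp : Supports (dualBall a b) w p) (hq : Supports (dualBall a b) (w + h • p) q) :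
    inner ℝ w p ≤ inner ℝ w q := by
  obtain ⟨-, k, -, hk⟩ := exists_indicator_primitive_eq_max (p - q) le_rfl
  obtain ⟨-, l, -, hl⟩ := exists_indicator_primitive_eq_max (-p - -q) le_rfl
  simp only [zero_add] at hk hl
  have h1 := hp.inner_posPart_nonpos hab hh hq hk
  have hq' := hq.neg_dualBall
  rw [neg_add, ← smul_neg] at hq'
  have h2 := hp.neg_dualBall.inner_posPart_nonpos hab hh hq' hl
  -- The negative part of `P - Q` is the positive part for the pair `-p`, `-q`, so the symmetry of
  -- the dual ball supplies the other half.
  have e : p - q = k - l := eq_of_primitive_eq fun x hx => by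
    rw [primitive_sub k, hk x hx, hl x hx, primitive_sub, primitive_sub, primitive_neg,
      primitive_neg]
    rcases max_cases (primitive p x - primitive q x) 0 with h | h <;>
    rcases max_cases (-primitive p x - -primitive q x) 0 with h' | h' <;> linarith
  have e2 := congrArg (inner ℝ w) e
  rw [inner_sub_right, inner_sub_right] at e2
  rw [inner_neg_left] at h2
  linarith

theorem span_cutoff_dense :
    (Submodule.span ℝ (cutoff a b '' Icc a b)).topologicalClosure = ⊤ := by
  rw [Submodule.topologicalClosure_eq_top_iff, Submodule.eq_bot_iff]
  intro p hp
  refine eq_zero_of_primitive_eq_zero fun x hx => ?_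
  exact (Submodule.mem_orthogonal _ _).1 hp _ (Submodule.subset_span ⟨x, hx, rfl⟩)

/-- Step functions are dense, and pairing one with `p` gives a finite combination of values of the
primitive of `p`, each at most `1` in absolute value. -/
theorem exists_near_bounded_on_dualBall (z : L2Ioo a b) {ε : ℝ} (hε : 0 < ε) :
    ∃ g M, ‖z - g‖ < ε ∧ ∀ p ∈ dualBall a b, inner ℝ g p ≤ M := by
  have hz : z ∈ closure (Submodule.span ℝ (cutoff a b '' Icc a b) : Set (L2Ioo a b)) := by
    rw [← Submodule.topologicalClosure_coe, span_cutoff_dense]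
    trivial
  obtain ⟨g, hg, hzg⟩ := Metric.mem_closure_iff.1 hz ε hε
  have hM : ∃ M, ∀ p ∈ dualBall a b, |inner ℝ g p| ≤ M := by
    refine Submodule.span_induction (p := fun g _ => ∃ M, ∀ p ∈ dualBall a b, |inner ℝ g p| ≤ M)
      ?_ ?_ ?_ ?_ hg
    · rintro _ ⟨x, hx, rfl⟩
      exact ⟨1, fun p hp => hp.1 x hx⟩
    · exact ⟨0, fun p _ => by simp⟩
    · rintro x y - - ⟨M, hM⟩ ⟨N, hN⟩
      refine ⟨M + N, fun p hp => ?_⟩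
      rw [inner_add_left]
      exact (abs_add_le _ _).trans (add_le_add (hM p hp) (hN p hp))
    · rintro c x - ⟨M, hM⟩
      refine ⟨|c| * M, fun p hp => ?_⟩
      rw [real_inner_smul_left, abs_mul]
      exact mul_le_mul_of_nonneg_left (hM p hp) (abs_nonneg c)
  obtain ⟨M, hM⟩ := hM
  exact ⟨g, M, by rwa [← dist_eq_norm], fun p hp => (le_abs_self _).trans (hM p hp)⟩

end Primitive

/-! ### Total variation as the support function of the dual ball. -/

section TestFunctions

variable {a b : ℝ}

theorem memLp_deriv {v : ℝ → ℝ} (hv : ContDiff ℝ (⊤ : ℕ∞) v) (hc : HasCompactSupport v) :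
    MemLp (deriv v) 2 (volume.restrict (Ioo a b)) :=
  (hv.continuous_deriv (by simp)).memLp_of_hasCompactSupport hc.deriv

theorem primitive_toLp_deriv {v : ℝ → ℝ} (hv : ContDiff ℝ (⊤ : ℕ∞) v) (ha : v a = 0)
    (hd : MemLp (deriv v) 2 (volume.restrict (Ioo a b))) {x : ℝ} (hx : x ∈ Icc a b) :
    primitive (hd.toLp _) x = v x := by
  rw [primitive_toLp hd hx, intervalIntegral.integral_deriv_eq_sub, ha, sub_zero]
  · exact fun y _ => (hv.differentiable (by simp)).differentiableAt
  · exact (hv.continuous_deriv (by simp)).intervalIntegrable _ _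

theorem inner_toLp {f : ℝ → ℝ} (hf : MemLp f 2 (volume.restrict (Ioo a b))) (w : L2Ioo a b) :
    inner ℝ w (hf.toLp f) = ∫ x in Ioo a b, w x * f x := by
  rw [L2.inner_def]
  refine integral_congr_ae ?_
  filter_upwards [hf.coeFn_toLp] with x hx
  rw [hx, RCLike.inner_apply, conj_trivial, mul_comm]

theorem toLp_deriv_mem_dualBall (hab : a ≤ b) {v : ℝ → ℝ} (hv : v ∈ tvTestFunctions a b)
    (hd : MemLp (deriv v) 2 (volume.restrict (Ioo a b))) : hd.toLp _ ∈ dualBall a b := by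
  obtain ⟨hs, -, hsub, hle⟩ := hv
  have hz : ∀ x, x ∉ Ioo a b → v x = 0 := fun x hx =>
    image_eq_zero_of_notMem_tsupport fun h => hx (hsub h)
  have ha : v a = 0 := hz a (by simp)
  refine ⟨fun x hx => ?_, ?_⟩
  · rw [primitive_toLp_deriv hs ha hd hx]
    exact hle x
  · rw [primitive_toLp_deriv hs ha hd (right_mem_Icc.2 hab)]
    exact hz b (by simp)

theorem Supports.totalVar_le (hab : a ≤ b) {w p : L2Ioo a b} (h : Supports (dualBall a b) w p) :
    totalVar a b w ≤ ((inner ℝ w p : ℝ) : EReal) := by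
  refine iSup₂_le fun v hv => ?_
  have hd := memLp_deriv (a := a) (b := b) hv.1 hv.2.1
  rw [← inner_toLp hd]
  exact_mod_cast h.2 _ (toLp_deriv_mem_dualBall hab hv hd)

theorem totalVar_nonneg (a b : ℝ) (f : ℝ → ℝ) : 0 ≤ totalVar a b f := by
  have h0 : (0 : ℝ → ℝ) ∈ tvTestFunctions a b := by
    refine ⟨contDiff_const, HasCompactSupport.zero, ?_, by simp⟩
    simp [tsupport]
  refine le_trans ?_ (le_iSup₂ (f := fun v (_ : v ∈ tvTestFunctions a b) =>
    ((∫ x in Ioo a b, f x * deriv v x : ℝ) : EReal)) 0 h0)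
  simp

/-- The classes of the derivatives of smooth functions with compact support in `(a, b)`. -/
def testDerivs (a b : ℝ) : Submodule ℝ (L2Ioo a b) where
  carrier := {τ | ∃ v : ℝ → ℝ, ContDiff ℝ (⊤ : ℕ∞) v ∧ HasCompactSupport v ∧
    tsupport v ⊆ Ioo a b ∧ τ =ᵐ[volume.restrict (Ioo a b)] deriv v}
  add_mem' := by
    rintro σ τ ⟨v, hv, hvc, hvs, hσ⟩ ⟨w, hw, hwc, hws, hτ⟩
    refine ⟨v + w, hv.add hw, hvc.add hwc, (tsupport_add _ _).trans (union_subset hvs hws), ?_⟩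
    filter_upwards [hσ, hτ, Lp.coeFn_add σ τ] with x h1 h2 h3
    rw [h3, Pi.add_apply, h1, h2, deriv_add (hv.differentiable (by simp)).differentiableAt
      (hw.differentiable (by simp)).differentiableAt]
  zero_mem' := by
    refine ⟨0, contDiff_const, HasCompactSupport.zero, by simp [tsupport], ?_⟩
    filter_upwards [Lp.coeFn_zero ℝ 2 (volume.restrict (Ioo a b))] with x hx
    exact hx.trans (by simp)
  smul_mem' := by
    rintro c τ ⟨v, hv, hvc, hvs, hτ⟩
    refine ⟨fun x => c * v x, contDiff_const.mul hv, hvc.mul_left,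
      (tsupport_mul_subset_right (f := fun _ => c)).trans hvs, ?_⟩
    filter_upwards [hτ, Lp.coeFn_smul c τ] with x h1 h2
    rw [h2, Pi.smul_apply, h1, smul_eq_mul, deriv_const_mul_field]

/-- A smooth function with compact support in `(a, b)` and vanishing integral has a primitive of
the same kind. -/
theorem exists_deriv_eq_of_integral_eq_zero {k : ℝ → ℝ}
    (hk : ContDiff ℝ (⊤ : ℕ∞) k) (hkc : HasCompactSupport k) (hks : tsupport k ⊆ Ioo a b)
    (hint : ∫ x, k x = 0) :
    ∃ v : ℝ → ℝ, ContDiff ℝ (⊤ : ℕ∞) v ∧ HasCompactSupport v ∧ tsupport v ⊆ Ioo a b ∧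
      deriv v = k := by
  rcases (tsupport k).eq_empty_or_nonempty with he | hne
  · have : k = 0 := tsupport_eq_empty_iff.1 he
    exact ⟨0, contDiff_const, HasCompactSupport.zero, by simp [tsupport], by
      rw [this]; ext x; simp⟩
  obtain ⟨c, hc⟩ := hkc.isCompact.exists_isLeast hne
  obtain ⟨d, hd⟩ := hkc.isCompact.exists_isGreatest hne
  have hzero : ∀ x, x ∉ Icc c d → k x = 0 := fun x hx =>
    image_eq_zero_of_notMem_tsupport fun h => hx ⟨hc.2 h, hd.2 h⟩
  set v : ℝ → ℝ := fun x => ∫ y in c..x, k y with hv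
  have hder : ∀ x, HasDerivAt v (k x) x := fun x => hk.continuous.integral_hasStrictDerivAt c x
    |>.hasDerivAt
  have hderiv : deriv v = k := funext fun x => (hder x).deriv
  have hle : c ≤ d := hd.2 hc.1
  have hvz : ∀ x, x ∉ Icc c d → v x = 0 := by
    intro x hx
    rw [mem_Icc, not_and_or, not_le, not_le] at hx
    rcases hx with hx | hx
    · simp only [hv]
      rw [intervalIntegral.integral_symm, intervalIntegral.integral_of_le hx.le,
        integral_Ioc_eq_integral_Ioo, setIntegral_eq_zero_of_forall_eq_zero, neg_zero]
      exact fun y hy => hzero y fun h => not_lt.2 h.1 hy.2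
    · simp only [hv]
      rw [intervalIntegral.integral_of_le (hle.trans hx.le), ← integral_Icc_eq_integral_Ioc,
        setIntegral_eq_integral_of_forall_compl_eq_zero, hint]
      exact fun y hy => hzero y fun h => hy ⟨h.1, h.2.trans hx.le⟩
  have hts : tsupport v ⊆ Icc c d :=
    closure_minimal (fun x hx => by_contra fun h => hx (hvz x h)) isClosed_Icc
  refine ⟨v, ?_, ?_, hts.trans ?_, hderiv⟩
  · rw [contDiff_infty_iff_deriv]
    exact ⟨fun x => (hder x).differentiableAt, hderiv ▸ hk⟩
  · exact isCompact_Icc.of_isClosed_subset (isClosed_tsupport v) hts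
  · exact Icc_subset_Ioo (hks hc.1).1 (hks hd.1).2

theorem exists_contDiff_integral_eq_one (hab : a < b) :
    ∃ χ : ℝ → ℝ, ContDiff ℝ (⊤ : ℕ∞) χ ∧ HasCompactSupport χ ∧ tsupport χ ⊆ Ioo a b ∧
      ∫ x, χ x = 1 := by
  let f : ContDiffBump ((a + b) / 2) :=
    ⟨(b - a) / 8, (b - a) / 4, by linarith, by linarith⟩
  refine ⟨f.normed volume, f.contDiff_normed, f.hasCompactSupport_normed, ?_, f.integral_normed⟩
  rw [f.tsupport_normed_eq, Real.closedBall_eq_Icc]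
  change Icc ((a + b) / 2 - (b - a) / 4) ((a + b) / 2 + (b - a) / 4) ⊆ _
  exact Icc_subset_Ioo (by linarith) (by linarith)

theorem setIntegral_mul_eq_integral {f k : ℝ → ℝ} (hks : tsupport k ⊆ Ioo a b) :
    ∫ x in Ioo a b, f x * k x = ∫ x, f x * k x :=
  setIntegral_eq_integral_of_forall_compl_eq_zero fun x hx => by
    rw [image_eq_zero_of_notMem_tsupport fun h => hx (hks h), mul_zero]

theorem integrableOn_mul_of_hasCompactSupport {k : ℝ → ℝ} (hk : Continuous k) (hkc : HasCompactSupport k)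
    {f : ℝ → ℝ} (hf : IntegrableOn f (Ioo a b)) :
    IntegrableOn (fun x => f x * k x) (Ioo a b) := by
  obtain ⟨C, hC⟩ := hkc.exists_bound_of_continuous hk
  exact hf.mul_bdd hk.aestronglyMeasurable (Eventually.of_forall hC)

/-- The du Bois-Reymond argument: subtracting `m * χ`, with `∫ χ = 1`, from a test function `g` of
integral `m` leaves the derivative of a test function. -/
theorem ae_eq_const_of_mem_orthogonal_testDerivs (hab : a < b) {z : L2Ioo a b}
    (hz : z ∈ (testDerivs a b)ᗮ) : ∃ c : ℝ, ∀ᵐ x ∂volume.restrict (Ioo a b), z x = c := by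
  obtain ⟨χ, hχ, hχc, hχs, hχ1⟩ := exists_contDiff_integral_eq_one hab
  have hzI : IntegrableOn z (Ioo a b) := (Lp.memLp z).integrable one_le_two
  set c := ∫ x in Ioo a b, z x * χ x with hc
  refine ⟨c, ?_⟩
  rw [ae_restrict_iff' measurableSet_Ioo]
  have hzc : IntegrableOn (fun x => z x - c) (Ioo a b) :=
    hzI.sub (integrableOn_const measure_Ioo_lt_top.ne)
  have key := isOpen_Ioo.ae_eq_zero_of_integral_contDiff_smul_eq_zero (μ := volume)
    (f := fun x => z x - c) hzc.locallyIntegrableOn ?_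
  · filter_upwards [key] with x hx hxI
    exact sub_eq_zero.1 (hx hxI)
  intro g hg hgc hgs
  set m := ∫ x, g x with hm
  have hgi : Integrable g := hg.continuous.integrable_of_hasCompactSupport hgc
  have hχi : Integrable χ := hχ.continuous.integrable_of_hasCompactSupport hχc
  obtain ⟨v, hv, hvc, hvs, hvd⟩ := exists_deriv_eq_of_integral_eq_zero (a := a) (b := b)
    (k := fun x => g x - m * χ x) (hg.sub (contDiff_const.mul hχ))
    (hgc.sub hχc.mul_left)
    ((tsupport_sub _ _).trans (union_subset hgs
      ((tsupport_mul_subset_right (f := fun _ => m)).trans hχs)))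
    (by rw [integral_sub hgi (hχi.const_mul m), integral_const_mul, hχ1, mul_one, sub_self])
  have hd := memLp_deriv (a := a) (b := b) hv hvc
  have h0 : inner ℝ (hd.toLp _) z = 0 := (Submodule.mem_orthogonal _ _).1 hz _
    ⟨v, hv, hvc, hvs, hd.coeFn_toLp⟩
  rw [real_inner_comm, inner_toLp, hvd] at h0
  have i1 := integrableOn_mul_of_hasCompactSupport hg.continuous hgc hzI
  have i2 := integrableOn_mul_of_hasCompactSupport hχ.continuous hχc hzI
  have e1 : ∫ x in Ioo a b, z x * (g x - m * χ x) = (∫ x in Ioo a b, z x * g x) - m * c := by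
    rw [hc, ← integral_const_mul, ← integral_sub i1 (i2.const_mul m)]
    exact integral_congr_ae (Eventually.of_forall fun x => by ring)
  have e2 : ∫ x in Ioo a b, c * g x = c * m := by
    rw [setIntegral_mul_eq_integral (f := fun _ => c) hgs, integral_const_mul]
  rw [e1] at h0
  calc ∫ x, g x • (z x - c) = ∫ x, (z x - c) * g x := by simp_rw [smul_eq_mul, mul_comm]
    _ = ∫ x in Ioo a b, (z x - c) * g x := (setIntegral_mul_eq_integral hgs).symm
    _ = (∫ x in Ioo a b, z x * g x) - ∫ x in Ioo a b, c * g x := by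
      rw [← integral_sub i1 (hgi.const_mul c).integrableOn]
      exact integral_congr_ae (Eventually.of_forall fun x => by ring)
    _ = 0 := by rw [e2]; linarith

theorem mem_closure_testDerivs (hab : a < b) {p : L2Ioo a b} (hp : primitive p b = 0) :
    p ∈ closure (testDerivs a b : Set (L2Ioo a b)) := by
  rw [← Submodule.topologicalClosure_coe, SetLike.mem_coe,
    ← Submodule.orthogonal_orthogonal_eq_closure, Submodule.mem_orthogonal]
  intro z hz
  obtain ⟨c, hc⟩ := ae_eq_const_of_mem_orthogonal_testDerivs hab hz
  rw [primitive_eq_integral p (right_mem_Icc.2 hab.le), intervalIntegral.integral_of_le hab.le,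
    integral_Ioc_eq_integral_Ioo] at hp
  rw [L2.inner_def]
  calc ∫ x in Ioo a b, inner ℝ (z x) (p x) = ∫ x in Ioo a b, c * p x := by
        refine integral_congr_ae ?_
        filter_upwards [hc] with x hx
        rw [RCLike.inner_apply, conj_trivial, hx, mul_comm]
    _ = 0 := by rw [integral_const_mul, hp, mul_zero]

theorem inner_le_mul_of_mem_testDerivs {τ z : L2Ioo a b} {B J : ℝ} (hB : 0 < B)
    (hτ : τ ∈ testDerivs a b) (hbd : ∀ x ∈ Icc a b, |primitive τ x| ≤ B)
    (hJ : totalVar a b z ≤ (J : EReal)) : inner ℝ z τ ≤ B * J := by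
  obtain ⟨v, hv, hvc, hvs, hτv⟩ := hτ
  have hd := memLp_deriv (a := a) (b := b) hv hvc
  have hτe : τ = hd.toLp _ := Lp.ext (hτv.trans hd.coeFn_toLp.symm)
  have hz : ∀ x, x ∉ Ioo a b → v x = 0 := fun x hx =>
    image_eq_zero_of_notMem_tsupport fun h => hx (hvs h)
  have htest : (fun x => B⁻¹ * v x) ∈ tvTestFunctions a b := by
    refine ⟨contDiff_const.mul hv, hvc.mul_left,
      (tsupport_mul_subset_right (f := fun _ => B⁻¹)).trans hvs, fun x => ?_⟩
    by_cases hx : x ∈ Ioo a b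
    · have := hbd x (Ioo_subset_Icc_self hx)
      rw [hτe, primitive_toLp_deriv hv (hz a (by simp)) hd (Ioo_subset_Icc_self hx)] at this
      rw [abs_mul, abs_of_pos (inv_pos.2 hB), inv_mul_le_iff₀ hB, mul_one]
      exact this
    · simp [hz x hx]
  have h1 := (le_iSup₂ (f := fun v (_ : v ∈ tvTestFunctions a b) =>
    ((∫ x in Ioo a b, z x * deriv v x : ℝ) : EReal)) _ htest).trans hJ
  have h2 : ∫ x in Ioo a b, z x * deriv (fun x => B⁻¹ * v x) x ≤ J := by exact_mod_cast h1
  have h3 : ∫ x in Ioo a b, z x * deriv (fun x => B⁻¹ * v x) x = B⁻¹ * inner ℝ z τ := by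
    rw [hτe, inner_toLp hd, ← integral_const_mul]
    refine integral_congr_ae (Eventually.of_forall fun x => ?_)
    simp only [deriv_const_mul_field]
    ring
  rw [h3, inv_mul_le_iff₀ hB] at h2
  exact h2

/-- The total variation is the support function of `dualBall`. -/
theorem inner_le_totalVar (hab : a < b) {p : L2Ioo a b} (hp : p ∈ dualBall a b) (z : L2Ioo a b) :
    ((inner ℝ p z : ℝ) : EReal) ≤ totalVar a b z := by
  by_cases htop : totalVar a b z = ⊤
  · rw [htop]; exact le_top
  have hbot : totalVar a b z ≠ ⊥ := ne_bot_of_le_ne_bot EReal.zero_ne_bot (totalVar_nonneg a b z)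
  lift totalVar a b z to ℝ using ⟨htop, hbot⟩ with J hJ
  rw [EReal.coe_le_coe_iff]
  set K := √(volume.real (Ioo a b)) with hK
  have main : ∀ ε : ℝ, 0 < ε → inner ℝ p z ≤ (1 + K * ε) * J + ‖z‖ * ε := by
    intro ε hε
    -- An `L²` approximation of `p` is also a uniform approximation of its primitive, so the test
    -- function behind `τ` is bounded by `1 + K * ε` and can be rescaled.
    obtain ⟨τ, hτ, hpτ⟩ := Metric.mem_closure_iff.1 (mem_closure_testDerivs hab hp.2) ε hε
    rw [dist_eq_norm] at hpτ
    have hK0 : 0 ≤ K := Real.sqrt_nonneg _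
    have hbd : ∀ x ∈ Icc a b, |primitive τ x| ≤ 1 + K * ε := by
      intro x hx
      have h1 := hp.1 x hx
      have h2 := abs_primitive_le (p - τ) x
      rw [primitive_sub] at h2
      have h3 := abs_sub_abs_le_abs_sub (primitive τ x) (primitive p x)
      rw [abs_sub_comm] at h3
      have h4 := mul_le_mul_of_nonneg_left hpτ.le hK0
      linarith
    have h1 := inner_le_mul_of_mem_testDerivs (J := J) (by positivity) hτ hbd hJ.ge
    have h2 := real_inner_le_norm z (p - τ)
    have h3 := mul_le_mul_of_nonneg_left hpτ.le (norm_nonneg z)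
    rw [inner_sub_right] at h2
    rw [real_inner_comm]
    linarith
  have hlim : Tendsto (fun ε : ℝ => (1 + K * ε) * J + ‖z‖ * ε) (𝓝[>] 0) (𝓝 J) := by
    have hc : Continuous fun ε : ℝ => (1 + K * ε) * J + ‖z‖ * ε := by fun_prop
    have := (hc.tendsto 0).mono_left (nhdsWithin_le_nhds (s := Ioi 0))
    simpa using this
  exact ge_of_tendsto hlim (eventually_nhdsWithin_of_forall fun ε hε => main ε hε)

end TestFunctions

/-! ### Local constancy off the saturated set, and density. -/

section Staircasing

variable {a b : ℝ}

theorem IsTVFlow.exists_supports (hab : a < b) {u₀ : ℝ → ℝ} {u : ℝ → L2Ioo a b}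
    (hu : IsTVFlow a b u₀ u) {t : ℝ} (ht : 0 < t) :
    ∃ p, Supports (dualBall a b) (u t) p ∧
      ∀ᵐ x ∂volume.restrict (Ioo a b), u t x = u₀ x - t * p x := by
  obtain ⟨hL, hflow⟩ := hu
  obtain ⟨p, hp, hup⟩ := hflow.exists_supports (C := dualBall a b) zero_mem_dualBall
    isClosed_dualBall convex_dualBall (fun p hp z => inner_le_totalVar hab hp z)
    (fun w p h => h.totalVar_le hab.le)
    (fun w p q h hh h1 h2 => h1.inner_le_of_add_smul hab.le hh h2)
    (fun z ε hε => exists_near_bounded_on_dualBall z hε) ht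
  refine ⟨p, hp, ?_⟩
  rw [hup]
  filter_upwards [hL.coeFn_toLp, Lp.coeFn_sub (hL.toLp u₀) (t • p), Lp.coeFn_smul t p]
    with x h1 h2 h3
  rw [h2, Pi.sub_apply, h1, h3, Pi.smul_apply, smul_eq_mul]

/-- The set on which the primitive of `p` is not saturated. -/
def unsaturated (p : L2Ioo a b) : Set ℝ := {x ∈ Ioo a b | |primitive p x| < 1}

theorem isOpen_unsaturated (hab : a ≤ b) (p : L2Ioo a b) : IsOpen (unsaturated p) :=
  ((continuousOn_primitive p hab).mono Ioo_subset_Icc_self).abs.isOpen_inter_preimage isOpen_Ioo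
    isOpen_Iio

/-- The primitive satisfies `P² = 1` on the interval; differentiating gives `2 p P = 0`, and `P`
does not vanish. Squaring avoids deciding the sign of `P`. -/
theorem ae_eq_zero_of_disjoint_unsaturated {p : L2Ioo a b} (hp : p ∈ dualBall a b) {c d : ℝ}
    (hcd : Ioo c d ⊆ Ioo a b) (hdisj : Disjoint (Ioo c d) (unsaturated p)) :
    ∀ᵐ x ∂volume.restrict (Ioo c d), p x = 0 := by
  have hone : ∀ x ∈ Ioo c d, primitive p x * primitive p x = 1 := by
    intro x hx
    have h1 := hp.1 x (Ioo_subset_Icc_self (hcd hx))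
    have h2 : 1 ≤ |primitive p x| := not_lt.1 fun h =>
      disjoint_left.1 hdisj hx ⟨hcd hx, h⟩
    rw [← abs_mul_abs_self, le_antisymm h1 h2, mul_one]
  rw [ae_restrict_iff' measurableSet_Ioo]
  filter_upwards [ae_hasDerivAt_primitive p] with x hx hxI
  have h1 := hx (hcd hxI)
  have h2 := (h1.mul h1).unique ((hasDerivAt_const x (1 : ℝ)).congr_of_eventuallyEq
    (by filter_upwards [isOpen_Ioo.mem_nhds hxI] with y hy using hone y hy))
  have h3 := hone x hxI
  have h4 : p x * (primitive p x * primitive p x) = 0 := by linear_combination primitive p x / 2 * h2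
  rwa [h3, mul_one] at h4

/-- The perturbation `τ` is `w` minus its mean on `(c, d)`, extended by zero. Its primitive vanishes
outside the interval, so `p + ε • τ` is admissible for small `ε`, and maximality forces `∫ (w - m)²
≤ 0`. -/
theorem Supports.ae_const_of_Icc_subset {w p : L2Ioo a b} (h : Supports (dualBall a b) w p)
    {c d : ℝ} (hcd : c < d) (hsub : Icc c d ⊆ unsaturated p) :
    ∃ m : ℝ, ∀ᵐ x ∂volume.restrict (Ioo c d), w x = m := by
  have hc : c ∈ Ioo a b := (hsub (left_mem_Icc.2 hcd.le)).1
  have hd : d ∈ Ioo a b := (hsub (right_mem_Icc.2 hcd.le)).1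
  have hab : a ≤ b := hc.1.le.trans hc.2.le
  have hcd' : Ioo c d ⊆ Ioo a b := Ioo_subset_Ioo hc.1.le hd.2.le
  have hwi : IntervalIntegrable w volume c d :=
    w.intervalIntegrable (Ioo_subset_Icc_self hc) (Ioo_subset_Icc_self hd)
  set m := (d - c)⁻¹ * ∫ x in c..d, w x with hm
  refine ⟨m, ?_⟩
  have hmem : MemLp ((Ioo c d).indicator fun x => w x - m) 2 (volume.restrict (Ioo a b)) :=
    ((Lp.memLp w).sub (memLp_const m)).indicator measurableSet_Ioo
  set τ := hmem.toLp _ with hτ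
  have hint : ∫ x in c..d, (w x - m) = 0 := by
    rw [intervalIntegral.integral_sub hwi intervalIntegrable_const, intervalIntegral.integral_const,
      smul_eq_mul, hm, mul_inv_cancel_left₀ (sub_pos.2 hcd).ne', sub_self]
  have hval : ∀ x ∈ Icc a b, primitive τ x = ∫ y in Ioc a x ∩ Ioo c d, (w y - m) := by
    intro x hx
    rw [hτ, primitive_toLp hmem hx, intervalIntegral.integral_of_le hx.1,
      setIntegral_indicator measurableSet_Ioo]
  have hleft : ∀ x ∈ Icc a b, x ≤ c → primitive τ x = 0 := by
    intro x hx hxc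
    rw [hval x hx]
    have : Ioc a x ∩ Ioo c d = ∅ := by
      ext y
      simp only [mem_inter_iff, mem_Ioc, mem_Ioo, mem_empty_iff_false, iff_false]
      intro hy
      linarith [hy.1.2, hy.2.1]
    rw [this, setIntegral_empty]
  have hright : ∀ x ∈ Icc a b, d ≤ x → primitive τ x = 0 := by
    intro x hx hxd
    rw [hval x hx]
    have : Ioc a x ∩ Ioo c d = Ioo c d :=
      inter_eq_right.2 fun y hy => ⟨hc.1.trans hy.1, hy.2.le.trans hxd⟩
    rw [this, ← integral_Ioc_eq_integral_Ioo, ← intervalIntegral.integral_of_le hcd.le, hint]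
  obtain ⟨x₀, hx₀, hmax⟩ := isCompact_Icc.exists_isMaxOn (nonempty_Icc.2 hcd.le)
    (((continuousOn_primitive p hab).mono
      fun x hx => Ioo_subset_Icc_self (hsub hx).1).abs : ContinuousOn _ (Icc c d))
  have hη : 0 < 1 - |primitive p x₀| := sub_pos.2 (hsub hx₀).2
  set K := √(volume.real (Ioo a b)) * ‖τ‖ with hK
  have hK0 : 0 ≤ K := by positivity
  -- `K` bounds the primitive of `τ`, and compactness of `[c, d]` gives the positive margin in the
  -- numerator; the `+ 1` covers `K = 0`.
  set ε := (1 - |primitive p x₀|) / (K + 1) with hε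
  have hε0 : 0 < ε := by positivity
  have hεK : ε * K ≤ 1 - |primitive p x₀| := by
    have : ε * (K + 1) = 1 - |primitive p x₀| := div_mul_cancel₀ _ (by positivity)
    linarith
  have hmem2 : p + ε • τ ∈ dualBall a b := by
    refine ⟨fun x hx => ?_, ?_⟩
    · rw [primitive_add, primitive_smul]
      rcases le_or_gt x c with hxc | hxc
      · rw [hleft x hx hxc, mul_zero, add_zero]
        exact h.1.1 x hx
      rcases le_or_gt d x with hxd | hxd
      · rw [hright x hx hxd, mul_zero, add_zero]
        exact h.1.1 x hx
      have h1 : |primitive p x| ≤ |primitive p x₀| := hmax (Ioo_subset_Icc_self ⟨hxc, hxd⟩)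
      have h2 := mul_le_mul_of_nonneg_left (abs_primitive_le τ x) hε0.le
      have h3 := abs_add_le (primitive p x) (ε * primitive τ x)
      rw [abs_mul, abs_of_pos hε0] at h3
      linarith
    · rw [primitive_add, primitive_smul, hright b (right_mem_Icc.2 hab) hd.2.le, h.1.2]
      ring
  have hle : inner ℝ w τ ≤ 0 := by
    have h1 := h.2 _ hmem2
    rw [inner_add_right, real_inner_smul_right] at h1
    by_contra hc
    push Not at hc
    have := mul_pos hε0 hc
    linarith
  have hw2 : MemLp (fun x => w x - m) 2 (volume.restrict (Ioo c d)) :=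
    ((Lp.memLp w).sub (memLp_const m)).mono_measure (Measure.restrict_mono hcd' le_rfl)
  have heq : inner ℝ w τ = ∫ x in Ioo c d, (w x - m) ^ 2 := by
    have hw1 := hw2.integrable one_le_two
    rw [hτ, inner_toLp hmem]
    have e : (fun x => w x * (Ioo c d).indicator (fun x => w x - m) x)
        = (Ioo c d).indicator fun x => w x * (w x - m) := by
      ext x
      by_cases hx : x ∈ Ioo c d <;> simp [hx]
    rw [e, setIntegral_indicator measurableSet_Ioo, inter_eq_right.2 hcd']
    have e2 : ∀ x, w x * (w x - m) = (w x - m) ^ 2 + m * (w x - m) := fun x => by ring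
    simp_rw [e2]
    rw [integral_add hw2.integrable_sq (hw1.const_mul m), integral_const_mul,
      ← integral_Ioc_eq_integral_Ioo (f := fun x => w x - m),
      ← intervalIntegral.integral_of_le hcd.le, hint, mul_zero, add_zero]
  have hzero : ∫ x in Ioo c d, (w x - m) ^ 2 = 0 :=
    le_antisymm (heq ▸ hle) (integral_nonneg fun x => sq_nonneg _)
  rw [integral_eq_zero_iff_of_nonneg (fun x => sq_nonneg _) hw2.integrable_sq] at hzero
  filter_upwards [hzero] with x hx
  exact sub_eq_zero.1 (pow_eq_zero_iff two_ne_zero |>.1 hx)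

theorem constOnComponents_of_ae_const_on_Ioo {A : Set ℝ} (hA : IsOpen A) {f : ℝ → ℝ}
    (h : ∀ c d : ℝ, c < d → Icc c d ⊆ A → ∃ m : ℝ, ∀ᵐ x ∂volume.restrict (Ioo c d), f x = m) :
    ConstOnComponents A f := by
  intro x hx
  set K := connectedComponentIn A x with hK
  have hKo : IsOpen K := hA.connectedComponentIn
  have hKc : K.OrdConnected := isPreconnected_connectedComponentIn.ordConnected
  have hKA : K ⊆ A := connectedComponentIn_subset A x
  have hnear : ∀ y ∈ K, ∃ δ > 0, Icc (y - δ) (y + δ) ⊆ K := fun y hy => by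
    obtain ⟨δ, hδ, hsub⟩ := Metric.nhds_basis_closedBall.mem_iff.1 (hKo.mem_nhds hy)
    exact ⟨δ, hδ, by rwa [← Real.closedBall_eq_Icc]⟩
  obtain ⟨δ, hδ, hδK⟩ := hnear x (mem_connectedComponentIn hx)
  obtain ⟨m, hm⟩ := h (x - δ) (x + δ) (by linarith) (hδK.trans hKA)
  refine ⟨m, ?_⟩
  rw [ae_restrict_iff' hKo.measurableSet, ae_iff]
  refine measure_null_of_locally_null _ fun y hy => ?_
  have hyK : y ∈ K := by
    by_contra hc
    exact hy fun h => absurd h hc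
  obtain ⟨η, hη, hηK⟩ := hnear y hyK
  -- This interval contains the neighbourhoods of both `x` and `y`; its overlap with the former, of
  -- positive measure, forces its constant to be `m`.
  obtain ⟨m', hm'⟩ := h (min (x - δ) (y - η)) (max (x + δ) (y + η))
    ((min_le_left _ _).trans_lt (lt_max_of_lt_left (by linarith))) <| by
      refine (hKc.out ?_ ?_).trans hKA
      · rcases min_choice (x - δ) (y - η) with e | e <;> rw [e]
        · exact hδK (left_mem_Icc.2 (by linarith))
        · exact hηK (left_mem_Icc.2 (by linarith))
      · rcases max_choice (x + δ) (y + η) with e | e <;> rw [e]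
        · exact hδK (right_mem_Icc.2 (by linarith))
        · exact hηK (right_mem_Icc.2 (by linarith))
  have hmm : m = m' := by
    have h1 := ae_restrict_of_ae_restrict_of_subset
      (Ioo_subset_Ioo (min_le_left _ _) (le_max_left _ _)) hm'
    have : NeZero (volume.restrict (Ioo (x - δ) (x + δ))) := ⟨by
      rw [Ne, Measure.restrict_eq_zero, Real.volume_Ioo, ENNReal.ofReal_eq_zero]
      linarith⟩
    obtain ⟨z, hz1, hz2⟩ := (hm.and h1).exists
    exact hz1.symm.trans hz2
  have h2 := ae_restrict_of_ae_restrict_of_subset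
    (Ioo_subset_Ioo (min_le_right _ _) (le_max_right _ _)) hm'
  rw [ae_restrict_iff' measurableSet_Ioo, ae_iff] at h2
  refine ⟨{z | ¬(z ∈ Ioo (y - η) (y + η) → f z = m')} ∩ Ioo (y - η) (y + η), ?_,
    measure_mono_null inter_subset_left h2⟩
  rw [mem_nhdsWithin]
  refine ⟨Ioo (y - η) (y + η), isOpen_Ioo, ⟨by linarith, by linarith⟩, fun z hz => ⟨?_, hz.1⟩⟩
  intro hc
  exact hz.2 fun _ => hmm ▸ hc hz.1

theorem tvTestFunctions_mono {c d : ℝ} (hcd : Ioo c d ⊆ Ioo a b) :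
    tvTestFunctions c d ⊆ tvTestFunctions a b :=
  fun _ hv => ⟨hv.1, hv.2.1, hv.2.2.1.trans hcd, hv.2.2.2⟩

theorem setIntegral_mul_deriv_le_totalVar {c d : ℝ} (hcd : Ioo c d ⊆ Ioo a b) (f : ℝ → ℝ)
    {v : ℝ → ℝ} (hv : v ∈ tvTestFunctions c d) :
    ((∫ x in Ioo c d, f x * deriv v x : ℝ) : EReal) ≤ totalVar a b f := by
  have hs : tsupport (deriv v) ⊆ Ioo c d := (tsupport_deriv_subset (f := v)).trans hv.2.2.1
  rw [setIntegral_mul_eq_integral hs, ← setIntegral_mul_eq_integral (hs.trans hcd)]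
  exact le_iSup₂ (f := fun v (_ : v ∈ tvTestFunctions a b) =>
    ((∫ x in Ioo a b, f x * deriv v x : ℝ) : EReal)) v (tvTestFunctions_mono hcd hv)

theorem neg_mem_tvTestFunctions {v : ℝ → ℝ} (hv : v ∈ tvTestFunctions a b) :
    -v ∈ tvTestFunctions a b := by
  refine ⟨hv.1.neg, hv.2.1.neg, ?_, fun x => ?_⟩
  · rw [tsupport_neg]
    exact hv.2.2.1
  · rw [Pi.neg_apply, abs_neg]
    exact hv.2.2.2 x

theorem totalVar_sub_le {c d : ℝ} (hcd : Ioo c d ⊆ Ioo a b) {f g h : ℝ → ℝ}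
    (hf : IntegrableOn f (Ioo a b)) (hg : IntegrableOn g (Ioo a b))
    (hh : ∀ᵐ x ∂volume.restrict (Ioo c d), h x = f x - g x) :
    totalVar c d h ≤ totalVar a b f + totalVar a b g := by
  refine iSup₂_le fun v hv => ?_
  have hvd : Continuous (deriv v) := hv.1.continuous_deriv (by simp)
  have i1 := integrableOn_mul_of_hasCompactSupport hvd hv.2.1.deriv (hf.mono_set hcd)
  have i2 := integrableOn_mul_of_hasCompactSupport hvd hv.2.1.deriv (hg.mono_set hcd)
  have e : ∫ x in Ioo c d, h x * deriv v x
      = (∫ x in Ioo c d, f x * deriv v x) + ∫ x in Ioo c d, g x * deriv (-v) x := by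
    have e1 : ∫ x in Ioo c d, g x * deriv (-v) x = -∫ x in Ioo c d, g x * deriv v x := by
      rw [← integral_neg]
      refine integral_congr_ae (Eventually.of_forall fun x => ?_)
      simp only [deriv.neg, mul_neg]
    rw [e1, ← sub_eq_add_neg, ← integral_sub i1 i2]
    refine integral_congr_ae ?_
    filter_upwards [hh] with x hx
    rw [hx]
    ring
  rw [e, EReal.coe_add]
  exact add_le_add (setIntegral_mul_deriv_le_totalVar hcd f hv)
    (setIntegral_mul_deriv_le_totalVar hcd g (neg_mem_tvTestFunctions hv))

theorem exists_rat_Ioo_disjoint_of_notMem_closure {A : Set ℝ} {x : ℝ} (hx : x ∈ Ioo a b)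
    (hxA : x ∉ closure A) :
    ∃ c d : ℚ, (c : ℝ) < d ∧ Ioo (c : ℝ) d ⊆ Ioo a b ∧ Disjoint (Ioo (c : ℝ) d) A := by
  have hn : Ioo a b ∩ (closure A)ᶜ ∈ 𝓝 x :=
    (isOpen_Ioo.inter isClosed_closure.isOpen_compl).mem_nhds ⟨hx, hxA⟩
  obtain ⟨l, r, hlr, hsub⟩ := mem_nhds_iff_exists_Ioo_subset.1 hn
  obtain ⟨c, hc1, hc2⟩ := exists_rat_btwn hlr.1
  obtain ⟨d, hd1, hd2⟩ := exists_rat_btwn hlr.2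
  have hss : Ioo (c : ℝ) d ⊆ Ioo a b ∩ (closure A)ᶜ :=
    (Ioo_subset_Ioo hc1.le hd2.le).trans hsub
  exact ⟨c, d, hc2.trans hd1, hss.trans inter_subset_left,
    disjoint_left.2 fun y hy hyA => (hss hy).2 (subset_closure hyA)⟩

end Staircasing

theorem mainTheorem5 {Ω : Type*} [MeasurableSpace Ω] (P : Measure Ω) [IsProbabilityMeasure P]
    (a b : ℝ) (hab : a < b)
    (ubar : ℝ → ℝ) (hubar : IsBV a b ubar)
    (n : Ω → ℝ → ℝ)
    (hnL2 : ∀ᵐ ω ∂P, MemLp (n ω) 2 (volume.restrict (Ioo a b)))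
    (hnVar : ∀ c d : ℝ, c < d → Ioo c d ⊆ Ioo a b → ∀ᵐ ω ∂P, totalVar c d (n ω) = ⊤) :
    ∀ᵐ ω ∂P, ∀ u : ℝ → L2Ioo a b, IsTVFlow a b (fun x => ubar x + n ω x) u →
      ∀ t : ℝ, 0 < t →
        ∃ A : Set ℝ, IsOpen A ∧ A ⊆ Ioo a b ∧ Ioo a b ⊆ closure A ∧
          ConstOnComponents A (u t) := by
  -- The null set in `hnVar` may depend on the interval; countably many rational intervals suffice
  -- for density.
  have hrat : ∀ᵐ ω ∂P, ∀ c d : ℚ, (c : ℝ) < d → Ioo (c : ℝ) d ⊆ Ioo a b →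
      totalVar c d (n ω) = ⊤ := by
    rw [ae_all_iff]; intro c
    rw [ae_all_iff]; intro d
    by_cases hcd : (c : ℝ) < d
    · by_cases hsub : Ioo (c : ℝ) d ⊆ Ioo a b
      · filter_upwards [hnVar c d hcd hsub] with ω hω _ _ using hω
      · exact Eventually.of_forall fun ω _ h => absurd h hsub
    · exact Eventually.of_forall fun ω h => absurd h hcd
  filter_upwards [hrat] with ω hω u hu t ht
  obtain ⟨p, hp, hup⟩ := hu.exists_supports hab ht
  refine ⟨unsaturated p, isOpen_unsaturated hab.le p, fun x hx => hx.1, fun x hx => ?_,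
    constOnComponents_of_ae_const_on_Ioo (isOpen_unsaturated hab.le p)
      fun c d hcd hsub => hp.ae_const_of_Icc_subset hcd hsub⟩
  by_contra hxA
  obtain ⟨c, d, hcd, hsub, hdisj⟩ := exists_rat_Ioo_disjoint_of_notMem_closure hx hxA
  -- On this interval `p = 0`, so the noise equals `u t - ubar`; the variation of `u t` is finite
  -- because it is bounded by `⟪u t, p⟫`.
  have hle : totalVar c d (n ω) ≤ totalVar a b (u t) + totalVar a b ubar := by
    refine totalVar_sub_le hsub ((Lp.memLp (u t)).integrable one_le_two) hubar.1 ?_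
    filter_upwards [ae_restrict_of_ae_restrict_of_subset hsub hup,
      ae_eq_zero_of_disjoint_unsaturated hp.1 hsub hdisj] with x h1 h2
    rw [h1, h2]
    ring
  rw [hω c d hcd hsub, top_le_iff] at hle
  have h1 : totalVar a b (u t) < ⊤ := (hp.totalVar_le hab.le).trans_lt (EReal.coe_lt_top _)
  exact (EReal.add_lt_top h1.ne hubar.2.ne).ne hle
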